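/- Let $M$ be a Hausdorff manifold of class $C^3$ (or smoother) and finite dimension, without boundary, with a metric $g$ of class $C^2$ that is Lorentzian, of signature $(-,+,\dots,+)$, at every point, and with a time orientation given by a continuous timelike vector field $u$. A tangent vector $v$ is future pointing timelike if $g(v,v)<0$ and $g(v,u)<0$. For $x,y\in U\subset M$ write $x\ll_U y$ if there is a $C^1$ path $\gamma:[0,1]\to U$ with $\gamma(0)=x$, $\gamma(1)=y$ whose tangent vector is future pointing timelike at every $t\in[0,1]$, and put $I^+_M=\{(x,y)\in M\times M: x\ll_M y\}$. For a relation $R\subset M\times M$, the transitive closed hull of $R$ is the smallest transitive relation on $M$ that contains $R$ and is closed as a subset of $M\times M$. Let $K^+_M$ be the transitive closed hull of $I^+_M$. Let $A\subset M$ be a finite set and put $$\widetilde I^+_M = I^+_M\cap\big((M-A)\times(M-A)\big),\qquad \widehat I^+_M=\{(x,y): x,y\notin A,\ x\ll_{M-A}y\}.$$ Then the transitive closed hull $\widetilde K^+_M$ of $\widetilde I^+_M$ equals $K^+_M$. Likewise, the transitive closed hull in $M\times M$ of $\widehat I^+_M$ equals $K^+_M$. -/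

import Mathlib

open Set Bundle
open scoped Manifold ContDiff

/-- A symmetric bilinear form (on a tangent space) has signature `(-, +, …, +)`: there is a
vector `v` of negative square on whose orthogonal complement the form is positive definite. -/
def HasLorentzSignature {V : Type*} [AddCommGroup V] [Module ℝ V] [TopologicalSpace V]
    (b : V →L[ℝ] V →L[ℝ] ℝ) : Prop :=
  ∃ v : V, b v v < 0 ∧ ∀ w : V, b v w = 0 → w ≠ 0 → 0 < b w w

/-- A globally Lorentzian, time-oriented metric structure on an `n`-dimensional manifold `M`:
a metric `g` of class `C^r` that is Lorentzian, with signature `(-, +, …, +)`, at every point,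
together with a continuous timelike vector field `u` that defines the time orientation. -/
structure LorentzianSpacetime (n : ℕ) (r : ℕ∞ω) (M : Type*) [TopologicalSpace M]
    [ChartedSpace (EuclideanSpace ℝ (Fin n)) M] [IsManifold (𝓡 n) 1 M] where
  /-- the metric tensor -/
  g (x : M) : TangentSpace (𝓡 n) x →L[ℝ] TangentSpace (𝓡 n) x →L[ℝ] ℝ
  g_symm (x : M) (v w : TangentSpace (𝓡 n) x) : g x v w = g x w v
  g_lorentz (x : M) : HasLorentzSignature (g x)
  g_contMDiff : ContMDiff (𝓡 n)
    ((𝓡 n).prod 𝓘(ℝ, EuclideanSpace ℝ (Fin n) →L[ℝ] EuclideanSpace ℝ (Fin n) →L[ℝ] ℝ)) r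
    (fun x ↦ TotalSpace.mk' (EuclideanSpace ℝ (Fin n) →L[ℝ] EuclideanSpace ℝ (Fin n) →L[ℝ] ℝ)
      x (g x))
  /-- the vector field that defines the time orientation -/
  u (x : M) : TangentSpace (𝓡 n) x
  u_timelike (x : M) : g x (u x) (u x) < 0
  u_continuous : Continuous (fun x ↦ (⟨x, u x⟩ : TangentBundle (𝓡 n) M))

namespace LorentzianSpacetime

variable {n : ℕ} {r : ℕ∞ω} {M : Type*} [TopologicalSpace M]
  [ChartedSpace (EuclideanSpace ℝ (Fin n)) M] [IsManifold (𝓡 n) 1 M]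

/-- A tangent vector `v` is timelike and future pointing: `g(v, v) < 0` and `g(v, u) < 0`. -/
def IsFutureTimelike (S : LorentzianSpacetime n r M) (x : M) (v : TangentSpace (𝓡 n) x) : Prop :=
  S.g x v v < 0 ∧ S.g x v (S.u x) < 0

/-- A future directed timelike path: a `C^1` map `γ : [0,1] → M` whose tangent vector at every
`t ∈ [0,1]` (one-sided at the end points) is future pointing and timelike. Only the values of `γ` on
`[0,1]` matter. -/
def IsFutureTimelikePath (S : LorentzianSpacetime n r M) (γ : ℝ → M) : Prop :=
  ContMDiffOn 𝓘(ℝ, ℝ) (𝓡 n) 1 γ (Icc 0 1) ∧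
    ∀ t ∈ Icc (0 : ℝ) 1,
      S.IsFutureTimelike (γ t) (mfderivWithin 𝓘(ℝ, ℝ) (𝓡 n) γ (Icc 0 1) t (1 : ℝ))

/-- `x <<_U y`: a future directed timelike path from `x` to `y` is totally contained in `U`. -/
def ChronIn (S : LorentzianSpacetime n r M) (U : Set M) (x y : M) : Prop :=
  ∃ γ : ℝ → M, S.IsFutureTimelikePath γ ∧ γ 0 = x ∧ γ 1 = y ∧ ∀ t ∈ Icc (0 : ℝ) 1, γ t ∈ U

/-- The chronology relation `I⁺ = {(x, y) : x << y}`, a subset of `M × M`. -/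
def chronology (S : LorentzianSpacetime n r M) : Set (M × M) :=
  {p | S.ChronIn univ p.1 p.2}

/-- The restriction `I⁺ ∩ (M - A) × (M - A)`; the paths may pass through `A`. -/
def chronologyRestrict (S : LorentzianSpacetime n r M) (A : Set M) : Set (M × M) :=
  S.chronology ∩ (Aᶜ ×ˢ Aᶜ)

/-- The chronology relation of `M - A`, regarded as a relation on `M`: pairs of points outside `A`
joined by a future directed timelike path that avoids `A`. -/
def chronologyAvoid (S : LorentzianSpacetime n r M) (A : Set M) : Set (M × M) :=
  {p | p.1 ∉ A ∧ p.2 ∉ A ∧ S.ChronIn Aᶜ p.1 p.2}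

end LorentzianSpacetime

/-- The transitive closed hull of a relation `R` on a topological space `X`: the smallest
transitive relation on `X` that contains `R` and is closed as a subset of `X × X`. -/
def transitiveClosedHull {X : Type*} [TopologicalSpace X] (R : Set (X × X)) : Set (X × X) :=
  ⋂₀ {T | R ⊆ T ∧ (∀ x y z : X, (x, y) ∈ T → (y, z) ∈ T → (x, z) ∈ T) ∧ IsClosed T}

/-- The hull is indeed the least closed transitive relation containing `R`. -/
theorem isLeast_transitiveClosedHull {X : Type*} [TopologicalSpace X] (R : Set (X × X)) :
    IsLeast {T | R ⊆ T ∧ (∀ x y z : X, (x, y) ∈ T → (y, z) ∈ T → (x, z) ∈ T) ∧ IsClosed T}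
      (transitiveClosedHull R) := by
  refine ⟨⟨fun p hp T hT ↦ hT.1 hp, ?_, isClosed_sInter fun T hT ↦ hT.2.2⟩,
    fun T hT ↦ sInter_subset_of_mem hT⟩
  intro x y z hxy hyz T hT
  exact hT.2.1 x y z (hxy T hT) (hyz T hT)

/-- The causal relation `K⁺` of a spacetime: the transitive closed hull of `I⁺`. -/
def LorentzianSpacetime.causalK {n : ℕ} {r : ℕ∞ω} {M : Type*} [TopologicalSpace M]
    [ChartedSpace (EuclideanSpace ℝ (Fin n)) M] [IsManifold (𝓡 n) 1 M]
    (S : LorentzianSpacetime n r M) : Set (M × M) :=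
  transitiveClosedHull S.chronology

/-! Hulls are monotone, so it suffices that every closed transitive `T` containing `chronologyAvoid
A` contains the whole chronology (`chronology_subset_of_chronologyAvoid_subset`). A timelike path
has nonzero velocity, hence just after any parameter `t` it avoids the finite set `A`, even if `γ t`
lies in `A`. Short pieces starting after `t` therefore give pairs in `T`; closedness lets their
starting points tend to `γ t`, and transitivity chains the steps. Continuous induction along `[0,1]`
then reaches the end point. -/

theorem transitiveClosedHull_mono {X : Type*} [TopologicalSpace X] {R R' : Set (X × X)}
    (h : R ⊆ R') : transitiveClosedHull R ⊆ transitiveClosedHull R' :=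
  (isLeast_transitiveClosedHull R).2
    ⟨h.trans (isLeast_transitiveClosedHull R').1.1, (isLeast_transitiveClosedHull R').1.2⟩

/-- A path in a manifold with nonzero velocity at `t` does not return to its position at `t`
immediately. -/
theorem HasMFDerivWithinAt.eventually_ne {n : ℕ} {M : Type*} [TopologicalSpace M]
    [ChartedSpace (EuclideanSpace ℝ (Fin n)) M] {γ : ℝ → M} {s : Set ℝ} {t : ℝ}
    {γ' : TangentSpace 𝓘(ℝ, ℝ) t →L[ℝ] TangentSpace (𝓡 n) (γ t)}
    (h : HasMFDerivWithinAt 𝓘(ℝ, ℝ) (𝓡 n) γ s t γ') (h0 : γ' (1 : ℝ) ≠ 0) :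
    ∀ᶠ t' in nhdsWithin t (s \ {t}), γ t' ≠ γ t := by
  have h2 := h.2
  simp only [writtenInExtChartAt, extChartAt_model_space_eq_id, PartialEquiv.refl_symm,
    PartialEquiv.refl_coe, CompTriple.comp_eq, Set.preimage_id_eq, id_eq, modelWithCornersSelf_coe,
    Set.range_id, Set.inter_univ] at h2
  have h3 : HasDerivWithinAt (extChartAt (𝓡 n) (γ t) ∘ γ) (γ' (1 : ℝ)) s t :=
    HasFDerivWithinAt.hasDerivWithinAt h2
  -- Equal points have equal chart images, so `γ t'` need not be known to lie in the chart domain.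
  filter_upwards [h3.eventually_ne (c := extChartAt (𝓡 n) (γ t) (γ t)) h0] with t' ht' he
  exact ht' (congrArg (extChartAt (𝓡 n) (γ t)) he)

namespace LorentzianSpacetime

variable {n : ℕ} {r : ℕ∞ω} {M : Type*} [TopologicalSpace M]
  [ChartedSpace (EuclideanSpace ℝ (Fin n)) M] [IsManifold (𝓡 n) 1 M]
  {S : LorentzianSpacetime n r M}

theorem ChronIn.mono {U V : Set M} (hUV : U ⊆ V) {x y : M} (h : S.ChronIn U x y) :
    S.ChronIn V x y := by
  obtain ⟨γ, hγ, h0, h1, hU⟩ := h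
  exact ⟨γ, hγ, h0, h1, fun t ht ↦ hUV (hU t ht)⟩

theorem IsFutureTimelike.ne_zero {x : M} {v : TangentSpace (𝓡 n) x}
    (h : S.IsFutureTimelike x v) : v ≠ 0 := by
  rintro rfl
  simpa using h.1

theorem IsFutureTimelike.smul {x : M} {v : TangentSpace (𝓡 n) x}
    (h : S.IsFutureTimelike x v) {c : ℝ} (hc : 0 < c) : S.IsFutureTimelike x (c • v) := by
  refine ⟨?_, ?_⟩
  · simpa using mul_neg_of_pos_of_neg hc (mul_neg_of_pos_of_neg hc h.1)
  · simpa using mul_neg_of_pos_of_neg hc h.2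

theorem IsFutureTimelikePath.hasMFDerivWithinAt {γ : ℝ → M} (h : S.IsFutureTimelikePath γ)
    {t : ℝ} (ht : t ∈ Icc (0 : ℝ) 1) :
    HasMFDerivWithinAt 𝓘(ℝ, ℝ) (𝓡 n) γ (Icc 0 1) t
      (mfderivWithin 𝓘(ℝ, ℝ) (𝓡 n) γ (Icc 0 1) t) :=
  (h.1.mdifferentiableOn one_ne_zero t ht).hasMFDerivWithinAt

/-- Affine reparametrizations of pieces of a timelike path are timelike paths. -/
theorem IsFutureTimelikePath.chronIn {γ : ℝ → M} (h : S.IsFutureTimelikePath γ) {a b : ℝ}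
    (ha : 0 ≤ a) (hab : a < b) (hb : b ≤ 1) {U : Set M} (hU : ∀ t ∈ Icc a b, γ t ∈ U) :
    S.ChronIn U (γ a) (γ b) := by
  set f : ℝ → ℝ := fun t ↦ a + t * (b - a) with hf
  have hfab : MapsTo f (Icc 0 1) (Icc a b) := fun t ht ↦
    ⟨by nlinarith [ht.1], by nlinarith [ht.2]⟩
  have hf01 : MapsTo f (Icc 0 1) (Icc 0 1) := fun t ht ↦
    Icc_subset_Icc ha hb (hfab ht)
  have hfd (t : ℝ) : HasDerivAt f (b - a) t := by
    rw [hf]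
    simpa using ((hasDerivAt_id t).mul_const (b - a)).const_add a
  have hfc : ContMDiff 𝓘(ℝ, ℝ) 𝓘(ℝ, ℝ) 1 f := by
    rw [contMDiff_iff_contDiff]
    fun_prop
  refine ⟨γ ∘ f, ⟨h.1.comp hfc.contMDiffOn hf01, fun t ht ↦ ?_⟩, by simp [hf], by simp [hf],
    fun t ht ↦ hU _ (hfab ht)⟩
  have hc := (h.hasMFDerivWithinAt (hf01 ht)).comp t
    (hfd t).hasFDerivAt.hasFDerivWithinAt.hasMFDerivWithinAt hf01
  rw [hc.mfderivWithin ((uniqueDiffOn_Icc zero_lt_one).uniqueMDiffOn t ht)]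
  have key : (mfderivWithin 𝓘(ℝ, ℝ) (𝓡 n) γ (Icc 0 1) (f t) ∘L
      ContinuousLinearMap.toSpanSingleton ℝ (b - a : ℝ)) (1 : ℝ) =
      (b - a) • mfderivWithin 𝓘(ℝ, ℝ) (𝓡 n) γ (Icc 0 1) (f t) (1 : ℝ) := by
    refine Eq.trans ?_ (ContinuousLinearMap.map_smul _ (b - a) (1 : ℝ))
    exact congrArg (mfderivWithin 𝓘(ℝ, ℝ) (𝓡 n) γ (Icc 0 1) (f t))
      ((one_mul (b - a)).trans (mul_one (b - a)).symm)
  have hv := (h.2 _ (hf01 ht)).smul (sub_pos.2 hab)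
  rw [← key] at hv
  exact hv

/-- A timelike path avoids a given finite set immediately after each parameter. -/
theorem IsFutureTimelikePath.exists_forall_Ioo_notMem [T1Space M] {γ : ℝ → M}
    (h : S.IsFutureTimelikePath γ) {A : Set M} (hA : A.Finite) {t : ℝ} (ht : t ∈ Ico (0 : ℝ) 1) :
    ∃ b ∈ Ioc t 1, ∀ t' ∈ Ioo t b, γ t' ∉ A := by
  have hd := h.hasMFDerivWithinAt (Ico_subset_Icc_self ht)
  have hA' : ∀ᶠ t' in nhdsWithin t (Icc 0 1 \ {t}), γ t' ∉ A := by
    have hcont := hd.continuousWithinAt.mono (sdiff_subset (t := {t}))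
    -- Continuity keeps the path off the points of `A` other than `γ t`; the nonzero velocity keeps
    -- it off `γ t` itself.
    have h1 := hcont.eventually ((hA.subset sdiff_subset).isClosed (s := A \ {γ t})
      |>.isOpen_compl.mem_nhds (by simp))
    filter_upwards [h1, hd.eventually_ne (h.2 t (Ico_subset_Icc_self ht)).ne_zero] with t' h1 h2 h3
    exact h1 ⟨h3, h2⟩
  have hle : nhdsWithin t (Ioi t) ≤ nhdsWithin t (Icc 0 1 \ {t}) := by
    rw [← nhdsWithin_Ioo_eq_nhdsGT ht.2]
    exact nhdsWithin_mono _ fun x hx ↦ ⟨⟨ht.1.trans hx.1.le, hx.2.le⟩, hx.1.ne'⟩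
  obtain ⟨b, hb, hbA⟩ := (mem_nhdsGT_iff_exists_mem_Ioc_Ioo_subset ht.2).1 (hle hA')
  exact ⟨b, hb, fun t' ht' ↦ hbA ht'⟩

theorem chronologyAvoid_subset_chronologyRestrict (A : Set M) :
    S.chronologyAvoid A ⊆ S.chronologyRestrict A :=
  fun _ hp ↦ ⟨hp.2.2.mono (subset_univ _), hp.1, hp.2.1⟩

/-- A closed transitive relation that contains the chronology relation of the complement of a
finite set contains the whole chronology relation. -/
theorem chronology_subset_of_chronologyAvoid_subset [T1Space M] {A : Set M} (hA : A.Finite)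
    {T : Set (M × M)} (hT : S.chronologyAvoid A ⊆ T)
    (htrans : ∀ x y z : M, (x, y) ∈ T → (y, z) ∈ T → (x, z) ∈ T) (hclosed : IsClosed T) :
    S.chronology ⊆ T := by
  rintro ⟨x, y⟩ ⟨γ, hγ, rfl, rfl, -⟩
  have hcont : ContinuousOn γ (Icc 0 1) := hγ.1.continuousOn
  have hpair : ContinuousOn (fun t ↦ (γ 0, γ t)) (Icc 0 1) := continuousOn_const.prodMk hcont
  -- The parameter `0` is adjoined by hand because `T` need not be reflexive.
  have hs : IsClosed (({0} ∪ {t | (γ 0, γ t) ∈ T}) ∩ Icc (0 : ℝ) 1) := by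
    rw [union_inter_distrib_right, inter_comm {t | (γ 0, γ t) ∈ T}]
    exact (isClosed_singleton.inter isClosed_Icc).union
      (hpair.preimage_isClosed_of_isClosed isClosed_Icc hclosed)
  have hsub : Icc (0 : ℝ) 1 ⊆ {0} ∪ {t | (γ 0, γ t) ∈ T} := by
    refine hs.Icc_subset_of_forall_exists_gt (by simp) fun t ht y hy ↦ ?_
    obtain ⟨b, hb, hbA⟩ := hγ.exists_forall_Ioo_notMem hA ht.2
    obtain ⟨t', ht', htb⟩ := exists_between (lt_min hy hb.1)
    rw [lt_min_iff] at htb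
    refine ⟨t', Or.inr ?_, ht', htb.1.le⟩
    have hstep : (γ t, γ t') ∈ T := by
      -- Since `γ t` may lie in `A`, the pair is obtained as a limit of pairs `(γ a, γ t')` with `a`
      -- decreasing to `t`.
      have hlim : Filter.Tendsto (fun a ↦ (γ a, γ t')) (nhdsWithin t (Ioo t t'))
          (nhds (γ t, γ t')) :=
        ((hcont t (Ico_subset_Icc_self ht.2)).mono fun a ha ↦
          ⟨ht.2.1.trans ha.1.le, ha.2.le.trans (htb.2.le.trans hb.2)⟩).prodMk_nhds
          tendsto_const_nhds
      have : (nhdsWithin t (Ioo t t')).NeBot := left_nhdsWithin_Ioo_neBot ht'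
      refine hclosed.mem_of_tendsto hlim (eventually_mem_nhdsWithin.mono fun a ha ↦ hT ?_)
      have hmem : ∀ c ∈ Icc a t', γ c ∈ Aᶜ := fun c hc ↦
        hbA c ⟨ha.1.trans_le hc.1, hc.2.trans_lt htb.2⟩
      exact ⟨hmem a (left_mem_Icc.2 ha.2.le), hmem t' (right_mem_Icc.2 ha.2.le),
        hγ.chronIn (ht.2.1.trans ha.1.le) ha.2 (htb.2.le.trans hb.2) hmem⟩
    rcases ht.1 with h0 | h0
    · rw [mem_singleton_iff] at h0
      rwa [h0] at hstep
    · exact htrans _ _ _ h0 hstep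
  rcases hsub (right_mem_Icc.2 zero_le_one) with h | h
  · exact absurd h one_ne_zero
  · exact h

end LorentzianSpacetime

theorem lemma2p4 {n : ℕ} {M : Type*} [TopologicalSpace M] [T2Space M]
    [ChartedSpace (EuclideanSpace ℝ (Fin n)) M] [IsManifold (𝓡 n) 3 M]
    (S : LorentzianSpacetime n 2 M) (A : Set M) (hA : A.Finite) :
    transitiveClosedHull (S.chronologyRestrict A) = S.causalK ∧
      transitiveClosedHull (S.chronologyAvoid A) = S.causalK := by
  have h1 : transitiveClosedHull (S.chronologyAvoid A) ⊆
      transitiveClosedHull (S.chronologyRestrict A) :=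
    transitiveClosedHull_mono (S.chronologyAvoid_subset_chronologyRestrict A)
  have h2 : transitiveClosedHull (S.chronologyRestrict A) ⊆ S.causalK :=
    transitiveClosedHull_mono inter_subset_left
  have h3 : S.causalK ⊆ transitiveClosedHull (S.chronologyAvoid A) := by
    have h := (isLeast_transitiveClosedHull (S.chronologyAvoid A)).1
    exact (isLeast_transitiveClosedHull S.chronology).2
      ⟨S.chronology_subset_of_chronologyAvoid_subset hA h.1 h.2.1 h.2.2, h.2⟩
  exact ⟨h2.antisymm (h3.trans h1), (h1.trans h2).antisymm h3⟩
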